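/- For a finite simple graph $G$ on at least two vertices, the algebraic connectivity $a(G)$ is the second smallest eigenvalue (counted with multiplicity) of the Laplacian matrix $D(G)-A(G)$, where $D(G)$ is the diagonal degree matrix and $A(G)$ the adjacency matrix. Let $n\ge 2$ and $n-1\le m\le \binom n2$ be integers and put $k=\lfloor 2m/n\rfloor$. Let $G$ be the graph on the vertices $1,\dots,n$ constructed as follows (all labels are taken modulo $n$ in $\{1,\dots,n\}$). **Case 1: $k$ even.** Connect each vertex $i$ with the vertices $i\pm j$, $1\le j\le k/2$. If $2m=nk+l$ with $l\ge 1$ (necessarily even), also connect $i$ with $i+\lfloor n/2\rfloor$ for $1\le i\le l/2$. **Case 2: $k$ odd, $n$ even.** Connect each vertex $i$ with the vertices $i\pm j$, $1\le j\le (k-1)/2$, and with $i+n/2$. If $2m=nk+l$ with $l\ge 1$ (necessarily even), also connect $i$ with $i+\frac{n-2}{2}$ for $1\le i\le l/2$. **Case 3: $k$ odd, $n$ odd.** Connect each vertex $i$ with the vertices $i\pm j$, $1\le j\le (k-1)/2$, and connect $i$ with $i+\frac{n-1}{2}$ for $1\le i\le \frac{n+1}{2}$. If $2m=nk+1+l$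 with $l\ge 1$ (necessarily even), also connect $i$ with $i+\frac{n-1}{2}$ for $\frac{n+3}{2}\le i\le \frac{n+1+l}{2}$. Suppose that $k\ge n+1-\sqrt{2n-3}$. Then $$a(G)\ \ge\ k-2\sqrt{k-1}.$$ Moreover this is nearly optimal, in the sense that every non-complete simple graph $H$ with $n$ vertices and $m$ edges satisfies $a(H)\le k$. -/

import Mathlib

namespace MinEnergyGraph

/-- The algebraic connectivity of a finite simple graph: the second smallest eigenvalue, counted
with multiplicity, of its Laplacian matrix. `eigenvalues₀` lists the eigenvalues in decreasing
order, so the second smallest one has index `card V - 2`. (Value `0` on fewer than two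
vertices, where there is no second eigenvalue.) -/
noncomputable def algebraicConnectivity {V : Type*} [Fintype V] (G : SimpleGraph V) : ℝ :=
  open Classical in
  if h : 2 ≤ Fintype.card V then
    (G.isHermitian_lapMatrix (R := ℝ)).eigenvalues₀ ⟨Fintype.card V - 2, by omega⟩
  else 0

/-- The vertices are labelled `1, …, n`: the element `v` of `Fin n = {0, …, n - 1}` has label
`v + 1`. -/
def label {n : ℕ} (v : Fin n) : ℕ := (v : ℕ) + 1

/-- The graph obtained by connecting each vertex `i` with the vertex with label
`(i + d) mod n`, for every `i` in the set `I` of labels. (`fromRel` symmetrizes the relation.) -/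
def chords (n : ℕ) (I : Finset ℕ) (d : ℕ) : SimpleGraph (Fin n) :=
  SimpleGraph.fromRel fun u v => label u ∈ I ∧ label u + d ≡ label v [MOD n]

/-- The graph obtained by connecting each vertex `i ∈ {1, …, n}` with the vertices with labels
`(i + j) mod n`, `j ∈ {±1, …, ±r}`. -/
def lattice (n r : ℕ) : SimpleGraph (Fin n) :=
  SimpleGraph.fromRel fun u v => ∃ j ∈ Finset.Icc 1 r, label u + j ≡ label v [MOD n]

/-- The base graph for `k` odd and `n` even. -/
def baseOddEven (n k : ℕ) : SimpleGraph (Fin n) :=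
  lattice n ((k - 1) / 2) ⊔ chords n (Finset.Icc 1 n) (n / 2)

/-- The base graph for `k` odd and `n` odd. -/
def baseOddOdd (n k : ℕ) : SimpleGraph (Fin n) :=
  lattice n ((k - 1) / 2) ⊔ chords n (Finset.Icc 1 ((n + 1) / 2)) ((n - 1) / 2)

/-- The graph built by the algorithm from `n` and `m`, where `n - 1 ≤ m ≤ n (n - 1) / 2` and
`k = ⌊2 m / n⌋` (division of natural numbers). The excess `l` is `2 m - n k`, respectively
`2 m - (n k + 1)` when `n` and `k` are both odd; these subtractions do not truncate. -/
def algorithmGraph (n m : ℕ) : SimpleGraph (Fin n) :=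
  let k := 2 * m / n
  if Even k then
    if 2 * m = n * k then lattice n (k / 2)
    else lattice n (k / 2) ⊔ chords n (Finset.Icc 1 ((2 * m - n * k) / 2)) (n / 2)
  else if Even n then
    if 2 * m = n * k then baseOddEven n k
    else baseOddEven n k ⊔ chords n (Finset.Icc 1 ((2 * m - n * k) / 2)) ((n - 2) / 2)
  else
    if 2 * m = n * k + 1 then baseOddOdd n k
    else baseOddOdd n k ⊔
      chords n (Finset.Icc ((n + 3) / 2) ((n + 1 + (2 * m - (n * k + 1))) / 2)) ((n - 1) / 2)

end MinEnergyGraph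

/-!
The lower bound only uses that every vertex of the constructed graph `G` has degree at least
`k - 1`. The construction contains the circulant graph `lattice n (k / 2)`, which already has
minimum degree at least `2 * (k / 2) ≥ k - 1`, so the additional chords may be ignored. On vectors
with coordinate sum zero, the Laplacian forms of `G` and of its complement add up to `n ‖x‖²`, and
the form of a graph of maximum degree `Δ` is at most `2 Δ ‖x‖²`. The complement has maximum degree
at most `n - k`, hence `a(G) ≥ n - 2 (n - k) = 2 k - n`
(`le_algebraicConnectivity_of_le_degree`), and the density hypothesis makes this at least
`k - 2 √(k - 1)` (`sub_two_mul_sqrt_le`).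

For the upper bound, let `v` be a vertex of minimum degree `δ` in a non-complete graph, with `r > 0`
non-neighbours. The vector that is `r` at `v`, `0` on the neighbours of `v` and `-1` elsewhere is
orthogonal to the all-ones vector and has Rayleigh quotient at most `δ`
(`algebraicConnectivity_le_degree`). Being an integer at most the average degree, `δ` is at most `k`.

Both parts use the variational description of the second smallest Laplacian eigenvalue on the
orthogonal complement of the all-ones vector, `algebraicConnectivity_le_of_dotProduct` and
`le_algebraicConnectivity_of_dotProduct`.
-/

namespace MinEnergyGraph

open Matrix

/-! ### Expansion of a quadratic form in an eigenbasis -/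

section Spectral

variable {V : Type*} [Fintype V] [DecidableEq V] {A : Matrix V V ℝ} (hA : A.IsHermitian)

theorem sum_eigenvectorBasis_dotProduct_mul (x y : V → ℝ) :
    ∑ i, (hA.eigenvectorBasis i ⬝ᵥ x) * (hA.eigenvectorBasis i ⬝ᵥ y) = x ⬝ᵥ y := by
  have h := hA.eigenvectorBasis.sum_inner_mul_inner (WithLp.toLp 2 x) (WithLp.toLp 2 y)
  simp only [EuclideanSpace.inner_eq_star_dotProduct, star_trivial] at h
  rw [dotProduct_comm x y, ← h]
  refine Finset.sum_congr rfl fun i _ => ?_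
  rw [dotProduct_comm y]

theorem eigenvectorBasis_dotProduct (i j : V) :
    hA.eigenvectorBasis i ⬝ᵥ hA.eigenvectorBasis j = if i = j then 1 else 0 := by
  have h := hA.eigenvectorBasis.inner_eq_ite i j
  rw [EuclideanSpace.inner_eq_star_dotProduct, star_trivial, dotProduct_comm] at h
  exact h

theorem dotProduct_mulVec_eq_sum_eigenvalues (x : V → ℝ) :
    x ⬝ᵥ (A *ᵥ x) = ∑ i, hA.eigenvalues i * (hA.eigenvectorBasis i ⬝ᵥ x) ^ 2 := by
  rw [← sum_eigenvectorBasis_dotProduct_mul hA]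
  refine Finset.sum_congr rfl fun i _ => ?_
  have hs : Aᵀ = A := by simpa using hA.eq
  rw [dotProduct_mulVec, ← mulVec_transpose, hs, hA.mulVec_eigenvectorBasis, smul_dotProduct,
    smul_eq_mul]
  ring

end Spectral

/-! ### Variational bounds for the algebraic connectivity -/

section Connectivity

open Classical in
/-- Here `p` and `q` are positions of the second smallest and of the smallest Laplacian eigenvalue;
all other eigenvalues are at least the algebraic connectivity. -/
theorem exists_eigenvalues_eq_algebraicConnectivity {V : Type*} [Fintype V] (G : SimpleGraph V)
    (hV : 2 ≤ Fintype.card V) :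
    ∃ p q : V, p ≠ q ∧
      (G.isHermitian_lapMatrix (R := ℝ)).eigenvalues p = algebraicConnectivity G ∧
      (G.isHermitian_lapMatrix (R := ℝ)).eigenvalues q ≤ algebraicConnectivity G ∧
      ∀ i, i ≠ q →
        algebraicConnectivity G ≤ (G.isHermitian_lapMatrix (R := ℝ)).eigenvalues i := by
  set e : Fin (Fintype.card V) ≃ V := Fintype.equivOfCardEq (Fintype.card_fin _) with he
  set hA := G.isHermitian_lapMatrix (R := ℝ)
  have hval (j) : hA.eigenvalues (e j) = hA.eigenvalues₀ j := by
    simp [IsHermitian.eigenvalues, ← he]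
  have ha : algebraicConnectivity G = hA.eigenvalues₀ ⟨Fintype.card V - 2, by omega⟩ := by
    rw [algebraicConnectivity, dif_pos hV]
  refine ⟨e ⟨Fintype.card V - 2, by omega⟩, e ⟨Fintype.card V - 1, by omega⟩, ?_, ?_, ?_, ?_⟩
  · rw [e.injective.ne_iff, Ne, Fin.mk.injEq]
    omega
  · rw [hval, ha]
  · rw [hval, ha]
    refine hA.eigenvalues₀_antitone ?_
    rw [Fin.mk_le_mk]
    omega
  · intro i hi
    obtain ⟨j, rfl⟩ := e.surjective i
    rw [hval, ha]
    refine hA.eigenvalues₀_antitone ?_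
    rw [e.injective.ne_iff, Ne, Fin.ext_iff] at hi
    have := j.isLt
    rw [Fin.le_def]
    simp only at hi ⊢
    omega

open Classical in
/-- Upper bound in the variational principle: the Rayleigh quotient of any nonzero vector orthogonal
to the all-ones vector bounds the algebraic connectivity from above. -/
theorem algebraicConnectivity_le_of_dotProduct {V : Type*} [Fintype V] (G : SimpleGraph V)
    (hV : 2 ≤ Fintype.card V) {c : ℝ} {x : V → ℝ} (hx : x ≠ 0) (hsum : ∑ v, x v = 0)
    (h : x ⬝ᵥ (G.lapMatrix ℝ *ᵥ x) ≤ c * (x ⬝ᵥ x)) : algebraicConnectivity G ≤ c := by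
  obtain ⟨p, q, -, -, -, hmin⟩ := exists_eigenvalues_eq_algebraicConnectivity G hV
  set hA := G.isHermitian_lapMatrix (R := ℝ)
  have hpos : 0 < x ⬝ᵥ x := by
    refine lt_of_le_of_ne (Finset.sum_nonneg fun i _ => mul_self_nonneg _) (Ne.symm ?_)
    rwa [Ne, dotProduct_self_eq_zero]
  have hpsd : ∀ i, 0 ≤ hA.eigenvalues i := (G.posSemidef_lapMatrix ℝ).eigenvalues_nonneg
  refine le_of_mul_le_mul_right (le_trans ?_ h) hpos
  rw [dotProduct_mulVec_eq_sum_eigenvalues hA]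
  rcases le_or_gt (algebraicConnectivity G) 0 with ha | ha
  · exact (mul_nonpos_of_nonpos_of_nonneg ha hpos.le).trans
      (Finset.sum_nonneg fun i _ => mul_nonneg (hpsd i) (sq_nonneg _))
  -- The all-ones vector lies in the kernel, so it is a multiple of the eigenvector at `q`.
  have hone : ∀ i, i ≠ q → hA.eigenvectorBasis i ⬝ᵥ (fun _ => (1 : ℝ)) = 0 := by
    have h0 := dotProduct_mulVec_eq_sum_eigenvalues hA (fun _ => (1 : ℝ))
    rw [G.lapMatrix_mulVec_const_eq_zero, dotProduct_zero, eq_comm,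
      Finset.sum_eq_zero_iff_of_nonneg fun i _ => mul_nonneg (hpsd i) (sq_nonneg _)] at h0
    intro i hi
    exact pow_eq_zero_iff two_ne_zero |>.mp
      ((mul_eq_zero.mp (h0 i (Finset.mem_univ i))).resolve_left (ha.trans_le (hmin i hi)).ne')
  have hself := sum_eigenvectorBasis_dotProduct_mul hA (fun _ => (1 : ℝ)) (fun _ => 1)
  have hx1 := sum_eigenvectorBasis_dotProduct_mul hA (fun _ => (1 : ℝ)) x
  rw [Fintype.sum_eq_single q fun i hi => by rw [hone i hi, zero_mul]] at hself hx1
  have hxq : hA.eigenvectorBasis q ⬝ᵥ x = 0 := by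
    have hs : (fun _ => (1 : ℝ)) ⬝ᵥ x = 0 := by simpa [dotProduct] using hsum
    rw [hs, mul_eq_zero] at hx1
    refine hx1.resolve_left fun h1 => ?_
    rw [h1, zero_mul] at hself
    have hcard : (0 : ℝ) = Fintype.card V := by simpa [dotProduct] using hself
    have : Fintype.card V = 0 := by exact_mod_cast hcard.symm
    omega
  rw [← sum_eigenvectorBasis_dotProduct_mul hA x x, Finset.mul_sum]
  refine Finset.sum_le_sum fun i _ => ?_
  by_cases hi : i = q
  · rw [hi, hxq]
    simp
  · rw [← sq]
    exact mul_le_mul_of_nonneg_right (hmin i hi) (sq_nonneg _)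

open Classical in
/-- Lower bound in the variational principle: the eigenvectors of the two smallest eigenvalues span
a plane, which contains a nonzero vector orthogonal to the all-ones vector. -/
theorem le_algebraicConnectivity_of_dotProduct {V : Type*} [Fintype V] (G : SimpleGraph V)
    (hV : 2 ≤ Fintype.card V) {c : ℝ}
    (h : ∀ x : V → ℝ, ∑ v, x v = 0 → c * (x ⬝ᵥ x) ≤ x ⬝ᵥ (G.lapMatrix ℝ *ᵥ x)) :
    c ≤ algebraicConnectivity G := by
  obtain ⟨p, q, hpq, hp, hq, -⟩ := exists_eigenvalues_eq_algebraicConnectivity G hV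
  set hA := G.isHermitian_lapMatrix (R := ℝ)
  -- Some nonzero combination of the two last eigenvectors is orthogonal to the all-ones vector.
  obtain ⟨s, t, hst, hsum⟩ : ∃ s t : ℝ, 0 < s ^ 2 + t ^ 2 ∧
      ∑ v, (s • ⇑(hA.eigenvectorBasis p) + t • ⇑(hA.eigenvectorBasis q)) v = 0 := by
    simp only [Pi.add_apply, Pi.smul_apply, smul_eq_mul, Finset.sum_add_distrib, ← Finset.mul_sum]
    set α := ∑ v, hA.eigenvectorBasis p v
    set β := ∑ v, hA.eigenvectorBasis q v
    by_cases hα : α = 0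
    · exact ⟨1, 0, by norm_num, by rw [hα]; ring⟩
    · exact ⟨β, -α, by rw [neg_sq]; positivity, by ring⟩
  set x : V → ℝ := s • ⇑(hA.eigenvectorBasis p) + t • ⇑(hA.eigenvectorBasis q)
  have hcoef (i) : hA.eigenvectorBasis i ⬝ᵥ x =
      s * (if i = p then 1 else 0) + t * (if i = q then 1 else 0) := by
    rw [dotProduct_add, dotProduct_smul, dotProduct_smul, eigenvectorBasis_dotProduct,
      eigenvectorBasis_dotProduct, smul_eq_mul, smul_eq_mul]
  have hzero (i) (hi : i ≠ p ∧ i ≠ q) : hA.eigenvectorBasis i ⬝ᵥ x = 0 := by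
    simp [hcoef, hi.1, hi.2]
  have hxp : hA.eigenvectorBasis p ⬝ᵥ x = s := by simp [hcoef, hpq]
  have hxq : hA.eigenvectorBasis q ⬝ᵥ x = t := by simp [hcoef, hpq.symm]
  have hx := h x hsum
  rw [dotProduct_mulVec_eq_sum_eigenvalues hA, ← sum_eigenvectorBasis_dotProduct_mul hA x x,
    Fintype.sum_eq_add p q hpq fun i hi => by rw [hzero i hi, zero_mul],
    Fintype.sum_eq_add p q hpq fun i hi => by rw [hzero i hi]; ring, hxp, hxq, hp] at hx
  refine le_of_mul_le_mul_right (hx.trans ?_) (by simpa [sq] using hst)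
  linarith [mul_le_mul_of_nonneg_right hq (sq_nonneg t)]

end Connectivity

/-! ### Degree bounds for the algebraic connectivity -/

section Degree

variable {V : Type*} [Fintype V] [DecidableEq V] (G : SimpleGraph V) [DecidableRel G.Adj]

theorem dotProduct_lapMatrix_mulVec (x : V → ℝ) :
    x ⬝ᵥ (G.lapMatrix ℝ *ᵥ x) =
      (∑ i, ∑ j, if G.Adj i j then (x i - x j) ^ 2 else 0) / 2 := by
  rw [← G.lapMatrix_toLinearMap₂' ℝ, toLinearMap₂'_apply']

/-- Each edge contributes `(x i - x j) ^ 2 ≤ 2 * x i ^ 2 + 2 * x j ^ 2`. -/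
theorem dotProduct_lapMatrix_mulVec_le {d : ℝ} (hd : ∀ v, (G.degree v : ℝ) ≤ d) (x : V → ℝ) :
    x ⬝ᵥ (G.lapMatrix ℝ *ᵥ x) ≤ 2 * d * (x ⬝ᵥ x) := by
  have hsum : ∑ i, ∑ j, (if G.Adj i j then x i ^ 2 else 0) ≤ d * (x ⬝ᵥ x) := by
    rw [dotProduct, Finset.mul_sum]
    refine Finset.sum_le_sum fun i _ => ?_
    rw [← sq, ← Finset.sum_filter, Finset.sum_const, nsmul_eq_mul,
      ← G.neighborFinset_eq_filter, G.card_neighborFinset_eq_degree]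
    exact mul_le_mul_of_nonneg_right (hd i) (sq_nonneg _)
  have hsum' : ∑ i, ∑ j, (if G.Adj i j then x j ^ 2 else 0) ≤ d * (x ⬝ᵥ x) := by
    rw [Finset.sum_comm]
    simpa only [G.adj_comm] using hsum
  have hle : ∑ i, ∑ j, (if G.Adj i j then (x i - x j) ^ 2 else 0) ≤
      ∑ i, ∑ j, (2 * (if G.Adj i j then x i ^ 2 else 0) +
        2 * (if G.Adj i j then x j ^ 2 else 0)) := by
    refine Finset.sum_le_sum fun i _ => Finset.sum_le_sum fun j _ => ?_
    split_ifs
    · nlinarith [sq_nonneg (x i + x j)]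
    · simp
  simp only [Finset.sum_add_distrib, ← Finset.mul_sum] at hle
  rw [dotProduct_lapMatrix_mulVec]
  linarith

theorem dotProduct_lapMatrix_mulVec_add_compl (x : V → ℝ) (hx : ∑ v, x v = 0) :
    x ⬝ᵥ (G.lapMatrix ℝ *ᵥ x) + x ⬝ᵥ (Gᶜ.lapMatrix ℝ *ᵥ x) =
      Fintype.card V * (x ⬝ᵥ x) := by
  have hall : ∑ i, ∑ j, (x i - x j) ^ 2 = 2 * (Fintype.card V * (x ⬝ᵥ x)) := by
    simp only [sub_sq, Finset.sum_add_distrib, Finset.sum_sub_distrib, ← Finset.mul_sum, hx,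
      ← Finset.sum_mul, Finset.sum_const, Finset.card_univ, nsmul_eq_mul, dotProduct, ← sq]
    ring
  rw [dotProduct_lapMatrix_mulVec, dotProduct_lapMatrix_mulVec, ← add_div,
    ← Finset.sum_add_distrib, div_eq_iff two_ne_zero, mul_comm _ (2 : ℝ), ← hall]
  refine Finset.sum_congr rfl fun i _ => ?_
  rw [← Finset.sum_add_distrib]
  refine Finset.sum_congr rfl fun j _ => ?_
  by_cases hij : i = j
  · simp [hij]
  · by_cases hadj : G.Adj i j <;> simp [hij, hadj]

/-- The complement has maximum degree at most `card V - 1 - d`, so its Laplacian form is at most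
`2 * (card V - 1 - d) * (x ⬝ᵥ x)`. -/
theorem le_algebraicConnectivity_of_le_degree (hV : 2 ≤ Fintype.card V) {d : ℝ}
    (hd : ∀ v, d ≤ G.degree v) :
    2 * d + 2 - Fintype.card V ≤ algebraicConnectivity G := by
  refine le_algebraicConnectivity_of_dotProduct G hV fun x hx => ?_
  have hcompl : ∀ v, (Gᶜ.degree v : ℝ) ≤ Fintype.card V - 1 - d := by
    intro v
    have h := G.degree_compl v
    have h1 := G.degree_lt_card_verts v
    have h2 : Gᶜ.degree v + G.degree v + 1 = Fintype.card V := by omega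
    have h3 : (Gᶜ.degree v : ℝ) + G.degree v + 1 = Fintype.card V := by exact_mod_cast h2
    linarith [hd v]
  have h1 := dotProduct_lapMatrix_mulVec_le Gᶜ hcompl x
  have h2 := dotProduct_lapMatrix_mulVec_add_compl G x hx
  have h3 : x ⬝ᵥ (G.lapMatrix ℝ *ᵥ x) =
      Fintype.card V * (x ⬝ᵥ x) - x ⬝ᵥ (Gᶜ.lapMatrix ℝ *ᵥ x) := by linarith
  convert! (show (2 * d + 2 - Fintype.card V) * (x ⬝ᵥ x) ≤ x ⬝ᵥ (G.lapMatrix ℝ *ᵥ x) by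
    rw [h3]; linarith)

/-- The test vector is supported on `v` and its non-neighbours: it takes the value `r` at `v` and
`-1` at each of the `r` non-neighbours. -/
theorem algebraicConnectivity_le_degree {v : V} (hv : G.degree v + 1 < Fintype.card V) :
    algebraicConnectivity G ≤ G.degree v := by
  set r : ℝ := Fintype.card V - 1 - G.degree v with hr
  have hr1 : 0 < r := by
    have : (G.degree v : ℝ) + 1 < Fintype.card V := by exact_mod_cast hv
    linarith
  have hcompl : (Gᶜ.degree v : ℝ) = r := by
    have h := G.degree_compl v
    have h2 : Gᶜ.degree v + G.degree v + 1 = Fintype.card V := by omega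
    have h3 : (Gᶜ.degree v : ℝ) + G.degree v + 1 = Fintype.card V := by exact_mod_cast h2
    linarith
  set x : V → ℝ := fun u => (if u = v then r else 0) - (if Gᶜ.Adj v u then 1 else 0) with hx
  have hxv : x v = r := by simp [hx]
  have hx0 (u) (hu : G.Adj v u) : x u = 0 := by simp [hx, hu, hu.ne']
  have hx1 (u) (hu : ¬G.Adj v u) (huv : u ≠ v) : x u = -1 := by simp [hx, hu, huv, huv.symm]
  have hsum : ∑ u, x u = 0 := by
    rw [Finset.sum_sub_distrib, ← Gᶜ.degree_eq_sum_if_adj, hcompl]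
    simp
  have hne : x ≠ 0 := fun h => hr1.ne' (by rw [← hxv, h, Pi.zero_apply])
  -- Every edge with nonconstant `x` has an end in the neighbourhood of `v`, where `x` vanishes.
  have hle : ∑ i, ∑ j, (if G.Adj i j then (x i - x j) ^ 2 else 0) ≤
      ∑ i, ∑ j, ((if G.Adj v j then x i ^ 2 else 0) + (if G.Adj v i then x j ^ 2 else 0)) := by
    refine Finset.sum_le_sum fun i _ => Finset.sum_le_sum fun j _ => ?_
    have hnonneg : 0 ≤ (if G.Adj v j then x i ^ 2 else 0) + (if G.Adj v i then x j ^ 2 else 0) := by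
      positivity
    by_cases hij : G.Adj i j
    swap
    · rwa [if_neg hij]
    by_cases hi : G.Adj v i
    · simp only [hij, hi, hx0 i hi, if_true]
      split_ifs <;> nlinarith
    by_cases hj : G.Adj v j
    · simp [hij, hi, hj, hx0 j hj]
    have hiv : i ≠ v := by rintro rfl; exact hj hij
    have hjv : j ≠ v := by rintro rfl; exact hi hij.symm
    simp [hi, hj, hx1 i hi hiv, hx1 j hj hjv]
  have hdeg : ∑ i, ∑ j, (if G.Adj v j then x i ^ 2 else 0) = G.degree v * (x ⬝ᵥ x) := by
    simp only [← Finset.sum_filter, Finset.sum_const, ← G.neighborFinset_eq_filter,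
      G.card_neighborFinset_eq_degree, nsmul_eq_mul, ← Finset.mul_sum, dotProduct, ← sq]
  have hdeg' : ∑ i, ∑ j, (if G.Adj v i then x j ^ 2 else 0) = G.degree v * (x ⬝ᵥ x) := by
    rw [Finset.sum_comm, hdeg]
  simp only [Finset.sum_add_distrib] at hle
  rw [hdeg, hdeg'] at hle
  have hquad : x ⬝ᵥ (G.lapMatrix ℝ *ᵥ x) ≤ G.degree v * (x ⬝ᵥ x) := by
    rw [dotProduct_lapMatrix_mulVec]
    linarith
  refine algebraicConnectivity_le_of_dotProduct G (by omega) hne hsum ?_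
  convert! hquad

/-- For a non-complete graph, the minimum degree bounds the algebraic connectivity, and the
handshake lemma bounds the minimum degree by the floor of the average degree. -/
theorem algebraicConnectivity_le_floor_average_degree (hG : G ≠ ⊤) :
    algebraicConnectivity G ≤ (2 * G.edgeFinset.card / Fintype.card V : ℕ) := by
  have hne : Nonempty V := by
    by_contra h
    rw [not_nonempty_iff] at h
    exact hG (Subsingleton.elim _ _)
  obtain ⟨v, hv⟩ := G.exists_minimal_degree_vertex
  have hlt : G.degree v + 1 < Fintype.card V := by
    by_contra h
    refine hG (top_unique fun u w huw => ?_)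
    have hu : Fintype.card V - 1 ≤ G.degree u := by
      have := G.minDegree_le_degree u
      omega
    have hcompl : Gᶜ.degree u = 0 := by
      rw [G.degree_compl]
      omega
    by_contra hadj
    exact (Gᶜ.degree_pos_iff_exists_adj u).mpr ⟨w, by simp_all⟩ |>.ne' hcompl
  refine (algebraicConnectivity_le_degree G hlt).trans ?_
  rw [Nat.cast_le, Nat.le_div_iff_mul_le Fintype.card_pos, ← G.sum_degrees_eq_twice_card_edges,
    mul_comm, ← smul_eq_mul, ← Finset.card_univ]
  exact Finset.card_nsmul_le_sum _ _ _ fun u _ => hv ▸ G.minDegree_le_degree u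

end Degree

/-! ### Degrees in the constructed graph -/

section Lattice

/-- For odd `k`, the lattice part of the construction has radius `(k - 1) / 2 = k / 2`. -/
theorem lattice_le_algorithmGraph (n m : ℕ) : lattice n (2 * m / n / 2) ≤ algorithmGraph n m := by
  simp only [algorithmGraph, baseOddEven, baseOddOdd]
  by_cases hk : Even (2 * m / n)
  · rw [if_pos hk]
    split_ifs <;> simp
  · have hpred : (2 * m / n - 1) / 2 = 2 * m / n / 2 := by
      have hodd := Nat.not_even_iff.mp hk
      generalize 2 * m / n = k at hodd ⊢
      omega
    rw [if_neg hk, hpred]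
    split_ifs <;> simp [le_sup_left, sup_assoc]

theorem lattice_adj_of_mod {n r : ℕ} (hr : 2 * r < n) {u v : Fin n} {j : ℕ}
    (hj : j ∈ Finset.Icc 1 r) (h : (v : ℕ) = (u + j) % n) : (lattice n r).Adj u v := by
  rw [Finset.mem_Icc] at hj
  rw [lattice, SimpleGraph.fromRel_adj]
  refine ⟨?_, Or.inl ⟨j, Finset.mem_Icc.mpr hj, ?_⟩⟩
  · rintro rfl
    rcases lt_or_ge ((u : ℕ) + j) n with hlt | hge
    · rw [Nat.mod_eq_of_lt hlt] at h
      omega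
    · rw [Nat.mod_eq_sub_mod hge, Nat.mod_eq_of_lt (by omega)] at h
      omega
  · have : (u : ℕ) + j ≡ v [MOD n] := by
      rw [h]
      exact (Nat.mod_modEq _ _).symm
    have := this.add_right 1
    rwa [add_right_comm] at this

/-- The condition `2 * r < n` keeps the `2 * r` neighbours `u ± j` of `u` distinct. -/
theorem two_mul_le_degree_lattice {n r : ℕ} (hr : 2 * r < n) (u : Fin n)
    [Fintype ((lattice n r).neighborSet u)] : 2 * r ≤ (lattice n r).degree u := by
  have hn : 0 < n := by omega
  -- The offsets `1, …, r` and `-r, …, -1`, the latter written as `n - r, …, n - 1`.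
  set D : Finset ℕ := Finset.Icc 1 r ∪ Finset.Ico (n - r) n with hD
  have hcard : D.card = 2 * r := by
    rw [hD, Finset.card_union_of_disjoint, Nat.card_Icc, Nat.card_Ico]
    · omega
    · rw [Finset.disjoint_left]
      intro a
      rw [Finset.mem_Icc, Finset.mem_Ico]
      omega
  rw [← hcard, ← SimpleGraph.card_neighborFinset_eq_degree]
  refine Finset.card_le_card_of_injOn (fun d => ⟨(u + d) % n, Nat.mod_lt _ hn⟩) ?_ ?_
  · intro d hd
    rw [Finset.mem_coe, hD, Finset.mem_union] at hd
    rw [Finset.mem_coe, SimpleGraph.mem_neighborFinset]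
    rcases hd with hd | hd
    · exact lattice_adj_of_mod hr hd rfl
    · rw [Finset.mem_Ico] at hd
      refine (lattice_adj_of_mod hr (j := n - d) (Finset.mem_Icc.mpr (by omega)) ?_).symm
      rw [Nat.mod_add_mod, add_assoc, Nat.add_sub_cancel' hd.2.le, Nat.add_mod_right,
        Nat.mod_eq_of_lt u.isLt]
  · intro d hd e he hde
    have hlt : ∀ d ∈ D, d < n := by
      intro d hd
      rw [hD, Finset.mem_union, Finset.mem_Icc, Finset.mem_Ico] at hd
      omega
    have hmod : (u : ℕ) + d ≡ u + e [MOD n] := by simpa [Fin.ext_iff, Nat.ModEq] using hde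
    exact (Nat.ModEq.add_left_cancel' _ hmod).eq_of_lt_of_lt (hlt d hd) (hlt e he)

theorem two_mul_div_le_pred {n m : ℕ} (hm : m ≤ n.choose 2) : 2 * m / n ≤ n - 1 := by
  refine Nat.div_le_of_le_mul ?_
  rw [Nat.choose_two_right] at hm
  have := Nat.div_mul_le_self (n * (n - 1)) 2
  omega

theorem sub_one_le_degree_algorithmGraph {n m : ℕ} (hm : m ≤ n.choose 2) (u : Fin n)
    [Fintype ((algorithmGraph n m).neighborSet u)] :
    2 * m / n - 1 ≤ (algorithmGraph n m).degree u := by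
  classical
  have hk := two_mul_div_le_pred hm
  have hn := u.pos
  have hr : 2 * (2 * m / n / 2) < n := by omega
  have h1 := two_mul_le_degree_lattice hr u
  have h2 := SimpleGraph.degree_le_of_le (v := u) (lattice_le_algorithmGraph n m)
  omega

end Lattice

/-! ### The numerical inequality and the conclusion -/

/-- With `t = n - k`, the density hypothesis reads `t + 1 ≤ √(2 n - 3)`, while the claim is
`t ≤ 2 √(k - 1)`, that is, `(t + 2) ^ 2 ≤ 4 n`. -/
theorem sub_two_mul_sqrt_le {n k : ℝ} (hn : 2 ≤ n) (hkn : k ≤ n)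
    (h : n + 1 - √(2 * n - 3) ≤ k) : k - 2 * √(k - 1) ≤ 2 * (k - 1) + 2 - n := by
  have hsq := Real.sq_sqrt (show 0 ≤ 2 * n - 3 by linarith)
  have hroot : (n - k) / 2 ≤ √(k - 1) := by
    apply Real.le_sqrt_of_sq_le
    nlinarith [sq_nonneg (√(2 * n - 3) - 1), Real.sqrt_nonneg (2 * n - 3)]
  linarith

end MinEnergyGraph

theorem mainTheorem6 (n m k : ℕ) (hn : 2 ≤ n) (hm : n - 1 ≤ m) (hm' : m ≤ n.choose 2)
    (hk : k = ⌊(2 * (m : ℝ)) / (n : ℝ)⌋₊)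
    (hdense : (n : ℝ) + 1 - Real.sqrt (2 * (n : ℝ) - 3) ≤ (k : ℝ)) :
    (k : ℝ) - 2 * Real.sqrt ((k : ℝ) - 1)
        ≤ MinEnergyGraph.algebraicConnectivity (MinEnergyGraph.algorithmGraph n m) ∧
      ∀ H : SimpleGraph (Fin n), H.edgeSet.ncard = m → H ≠ ⊤ →
        MinEnergyGraph.algebraicConnectivity H ≤ (k : ℝ) := by
  classical
  have hk' : k = 2 * m / n := by
    rw [hk, ← Nat.floor_div_eq_div (K := ℝ)]
    push_cast
    rfl
  constructor
  · have hkn : k ≤ n := by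
      have := MinEnergyGraph.two_mul_div_le_pred hm'
      omega
    have hdeg (v : Fin n) :
        (k : ℝ) - 1 ≤ (MinEnergyGraph.algorithmGraph n m).degree v := by
      have := MinEnergyGraph.sub_one_le_degree_algorithmGraph hm' v
      rw [← hk'] at this
      rw [sub_le_iff_le_add]
      exact_mod_cast Nat.sub_le_iff_le_add.mp this
    have h := MinEnergyGraph.le_algebraicConnectivity_of_le_degree
      (MinEnergyGraph.algorithmGraph n m) (by simpa using hn) hdeg
    rw [Fintype.card_fin] at h
    exact (MinEnergyGraph.sub_two_mul_sqrt_le (by exact_mod_cast hn)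
      (by exact_mod_cast hkn) hdense).trans h
  · intro H hH hne
    have h := MinEnergyGraph.algebraicConnectivity_le_floor_average_degree H hne
    rw [← SimpleGraph.coe_edgeFinset, Set.ncard_coe_finset] at hH
    rwa [Fintype.card_fin, hH, ← hk'] at h
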